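/- Let $\mathbb{N}=\{0,1,2,\dots\}$ and let $\beta\mathbb{N}$ be the space of all ultrafilters on $\mathbb{N}$, whose basic open sets are $\{\mathcal{U} : A\in\mathcal{U}\}$ for $A\subseteq\mathbb{N}$, with the semigroup operation $$A\in\mathcal{U}\oplus\mathcal{V}\iff\{m\in\mathbb{N} : \{n\in\mathbb{N} : m+n\in A\}\in\mathcal{V}\}\in\mathcal{U}.$$ Let $K(\beta\mathbb{N},\oplus)$ be the smallest (nonempty) two-sided ideal of this semigroup and $\overline{K(\beta\mathbb{N},\oplus)}$ its topological closure. For $A\subseteq\mathbb{N}$: - the upper Banach density of $A$ is $BD(A)=\limsup_{n\to\infty}\ \sup_{m\in\mathbb{N}}\frac{|A\cap[m,m+n)|}{n}$; - $A$ contains arbitrarily long arithmetic progressions if for every $k$ there are $a,d\in\mathbb{N}$ with $d>0$ and $a+id\in A$ for all $0\le i<k$; - $A$ is piecewise syndetic if for some $n\in\mathbb{N}$ the set $\bigcup_{i=1}^{n}(A+i)$ is thick, i.e. contains arbitrarily long intervals. If $\mathcal{U}\in\overline{K(\beta\mathbb{N},\oplus)}$, then every $A\in\mathcal{U}$ 1.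 has positive upper Banach density, $BD(A)>0$; 2. contains arbitrarily long arithmetic progressions; 3. is piecewise syndetic. Moreover, every piecewise syndetic set $A\subseteq\mathbb{N}$ contains arbitrarily long arithmetic progressions and satisfies $BD(A)>0$. -/

import Mathlib

open Set Filter Topology

attribute [local instance] Ultrafilter.add Ultrafilter.addSemigroup

/-- A (nonempty) two-sided ideal of an additively written semigroup `S`. -/
structure IsTwoSidedAddIdeal {S : Type*} [AddSemigroup S] (I : Set S) : Prop where
  nonempty : I.Nonempty
  add_left_mem : ∀ s : S, ∀ x ∈ I, s + x ∈ I
  add_right_mem : ∀ s : S, ∀ x ∈ I, x + s ∈ I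

/-- The smallest two-sided ideal `K(S)` of an additively written semigroup `S`: the intersection
of all its nonempty two-sided ideals. -/
def minimalAddIdeal (S : Type*) [AddSemigroup S] : Set S :=
  ⋂₀ {I : Set S | IsTwoSidedAddIdeal I}

/-- `K(βℕ, ⊕)`. Here `βℕ` is the space of ultrafilters on the discrete space `ℕ = {0, 1, 2, …}`, and
`A ∈ U ⊕ V` iff `{m | {n | m + n ∈ A} ∈ V} ∈ U`. -/
def kernelBetaNat : Set (Ultrafilter ℕ) :=
  minimalAddIdeal (Ultrafilter ℕ)

/-- The operation on `βℕ` is the usual one. -/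
theorem mem_ultrafilter_add_iff (U V : Ultrafilter ℕ) (A : Set ℕ) :
    A ∈ U + V ↔ {m : ℕ | {n : ℕ | m + n ∈ A} ∈ V} ∈ U :=
  Iff.rfl

/-- The intersection `K(βℕ, ⊕)` of all two-sided ideals is itself a (nonempty) two-sided ideal,
so it is the smallest one. -/
theorem isTwoSidedAddIdeal_kernelBetaNat : IsTwoSidedAddIdeal kernelBetaNat := by
  refine ⟨?_, fun s x hx I hI => hI.add_left_mem s x (hx I hI),
    fun s x hx I hI => hI.add_right_mem s x (hx I hI)⟩
  let C : Set (Set (Ultrafilter ℕ)) :=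
    {L | L.Nonempty ∧ IsClosed L ∧ ∀ s : Ultrafilter ℕ, ∀ x ∈ L, s + x ∈ L}
  obtain ⟨L, -, hL⟩ := zorn_superset_nonempty C (by
    intro c hc hchain hne
    refine ⟨⋂₀ c, ⟨?_, isClosed_sInter fun t ht => (hc ht).2.1, fun s x hx t ht =>
      (hc ht).2.2 s x (hx t ht)⟩, fun s hs => sInter_subset_of_mem hs⟩
    have := hne.to_subtype
    refine IsCompact.nonempty_sInter_of_directed_nonempty_isCompact_isClosed
      (fun a ha b hb => (hchain.total ha hb).elim
        (fun h => ⟨a, ha, Subset.rfl, h⟩) (fun h => ⟨b, hb, h, Subset.rfl⟩)) (fun t ht => (hc ht).1)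
      (fun t ht => (hc ht).2.1.isCompact) (fun t ht => (hc ht).2.1)) univ
      ⟨⟨pure 0, trivial⟩, isClosed_univ, fun _ _ _ => trivial⟩
  obtain ⟨x, hx⟩ := hL.prop.1
  refine ⟨x, fun I hI => ?_⟩
  obtain ⟨i, hi⟩ := hI.nonempty
  have hmem : range (fun s : Ultrafilter ℕ => s + (i + x)) ∈ C := by
    refine ⟨range_nonempty _, (isCompact_range (Ultrafilter.continuous_add_left _)).isClosed, ?_⟩
    rintro s _ ⟨t, rfl⟩
    exact ⟨s + t, add_assoc _ _ _⟩
  have hsub : range (fun s : Ultrafilter ℕ => s + (i + x)) ⊆ L := by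
    rintro _ ⟨t, rfl⟩
    exact hL.prop.2.2 _ _ (hL.prop.2.2 _ _ hx)
  obtain ⟨s, hs⟩ := hL.le_of_le hmem hsub hx
  rw [← hs]
  exact hI.add_left_mem _ _ (hI.add_right_mem _ _ hi)

/-- `T ⊆ ℕ` is thick: it contains arbitrarily long intervals. -/
def IsThickSet (T : Set ℕ) : Prop :=
  ∀ l : ℕ, ∃ a : ℕ, Ico a (a + l) ⊆ T

/-- `A ⊆ ℕ` is piecewise syndetic: `(A + 1) ∪ … ∪ (A + n)` is thick for some `n`. -/
def IsPiecewiseSyndetic (A : Set ℕ) : Prop :=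
  ∃ n : ℕ, IsThickSet (⋃ i ∈ Icc 1 n, (fun a => a + i) '' A)

/-- `A ⊆ ℕ` contains arithmetic progressions of every finite length (with nonzero difference). -/
def ContainsArbitrarilyLongAP (A : Set ℕ) : Prop :=
  ∀ k : ℕ, ∃ a d : ℕ, 0 < d ∧ ∀ i < k, a + i * d ∈ A

/-- The upper Banach density `BD(A) = limsup_{n → ∞} sup_m |A ∩ [m, m + n)| / n`. -/
noncomputable def upperBanachDensity (A : Set ℕ) : ℝ :=
  limsup (fun n : ℕ => ⨆ m : ℕ, ((A ∩ Ico m (m + n)).ncard : ℝ) / (n : ℝ)) atTop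

/-! The ultrafilters with only piecewise syndetic members form a two-sided ideal, nonempty by
partition regularity, so it contains the kernel. A member of an ultrafilter in the closure also
belongs to one in the kernel, hence is piecewise syndetic. Such a set has finitely many translates
covering long intervals: van der Waerden, with shifts as colours, gives progressions, and counting
gives density. -/

theorem isPiecewiseSyndetic_iff {A : Set ℕ} :
    IsPiecewiseSyndetic A ↔ ∃ n : ℕ, ∀ l : ℕ, ∃ a : ℕ, ∀ x, a ≤ x → x < a + l →
      ∃ i, 1 ≤ i ∧ i ≤ n ∧ ∃ y ∈ A, y + i = x := by
  simp [IsPiecewiseSyndetic, IsThickSet, Set.subset_def, and_assoc]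

theorem IsPiecewiseSyndetic.of_forall_add_mem {A B : Set ℕ} (hA : IsPiecewiseSyndetic A) (m : ℕ)
    (h : ∀ y ∈ A, m + y ∈ B) : IsPiecewiseSyndetic B := by
  rw [isPiecewiseSyndetic_iff] at hA ⊢
  obtain ⟨n, hn⟩ := hA
  refine ⟨n, fun l => ?_⟩
  obtain ⟨a, ha⟩ := hn l
  refine ⟨a + m, fun x hx hxl => ?_⟩
  obtain ⟨i, hi, hin, y, hy, hyx⟩ := ha (x - m) (by omega) (by omega)
  exact ⟨i, hi, hin, m + y, h y hy, by omega⟩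

theorem IsPiecewiseSyndetic.mono {A B : Set ℕ} (hA : IsPiecewiseSyndetic A) (h : A ⊆ B) :
    IsPiecewiseSyndetic B :=
  hA.of_forall_add_mem 0 fun y hy => by simpa using h hy

theorem isPiecewiseSyndetic_univ : IsPiecewiseSyndetic univ :=
  isPiecewiseSyndetic_iff.2 ⟨1, fun _ => ⟨1, fun x hx _ =>
    ⟨1, le_rfl, le_rfl, x - 1, trivial, by omega⟩⟩⟩

theorem not_isPiecewiseSyndetic_empty : ¬ IsPiecewiseSyndetic ∅ := by
  rw [isPiecewiseSyndetic_iff]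
  rintro ⟨n, hn⟩
  obtain ⟨a, ha⟩ := hn 1
  obtain ⟨-, -, -, y, hy, -⟩ := ha a le_rfl (by omega)
  exact hy

/-- Piecewise syndeticity is partition regular. -/
theorem IsPiecewiseSyndetic.of_union {A B : Set ℕ} (h : IsPiecewiseSyndetic (A ∪ B)) :
    IsPiecewiseSyndetic A ∨ IsPiecewiseSyndetic B := by
  simp only [isPiecewiseSyndetic_iff] at h ⊢
  obtain ⟨n, hn⟩ := h
  by_contra! hcon
  obtain ⟨l, hl⟩ := hcon.1 n
  -- The extra `l` shifts for `B` absorb the move from `z`, missed by `A`, up to `x ≤ z + l`, missed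
  -- by `B`.
  obtain ⟨L, hL⟩ := hcon.2 (n + l)
  obtain ⟨a, ha⟩ := hn (l + L)
  obtain ⟨x, hx, hxL, hB⟩ := hL (a + l)
  obtain ⟨z, hz, hzl, hA⟩ := hl (x - l)
  obtain ⟨i, hi, hin, y, hy | hy, hyz⟩ := ha z (by omega) (by omega)
  · exact hA i hi hin y hy hyz
  · exact hB (i + (x - z)) (by omega) (by omega) y hy (by omega)

/-- By partition regularity, the complements of non-piecewise-syndetic sets form a proper filter;
any ultrafilter refining it works. -/
theorem exists_ultrafilter_forall_isPiecewiseSyndetic :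
    ∃ U : Ultrafilter ℕ, ∀ A ∈ U, IsPiecewiseSyndetic A := by
  let F : Filter ℕ :=
    { sets := {A | ¬ IsPiecewiseSyndetic Aᶜ}
      univ_sets := by simpa using not_isPiecewiseSyndetic_empty
      sets_of_superset := fun hA hAB hB => hA (hB.mono (compl_subset_compl.2 hAB))
      inter_sets := fun {A B} hA hB h => by
        rw [compl_inter] at h
        exact h.of_union.elim hA hB }
  have : F.NeBot := by
    refine ⟨fun hF => ?_⟩
    have h : (∅ : Set ℕ) ∈ F := hF ▸ Filter.mem_bot
    exact h (by simpa using isPiecewiseSyndetic_univ)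
  refine ⟨Ultrafilter.of F, fun A hA => by_contra fun h => ?_⟩
  have hc : Aᶜ ∈ F := show ¬ IsPiecewiseSyndetic Aᶜᶜ by rwa [compl_compl]
  exact Ultrafilter.compl_mem_iff_notMem.1 (Ultrafilter.of_le F hc) hA

/-- The ultrafilters all of whose members are piecewise syndetic form a two-sided ideal. -/
theorem isTwoSidedAddIdeal_setOf_forall_isPiecewiseSyndetic :
    IsTwoSidedAddIdeal {U : Ultrafilter ℕ | ∀ A ∈ U, IsPiecewiseSyndetic A} := by
  refine ⟨exists_ultrafilter_forall_isPiecewiseSyndetic, fun S X hX A hA => ?_,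
    fun S X hX A hA => ?_⟩
  · obtain ⟨m, hm⟩ := S.nonempty_of_mem ((mem_ultrafilter_add_iff S X A).1 hA)
    exact (hX _ hm).of_forall_add_mem m fun _ hy => hy
  · have hB := hX _ ((mem_ultrafilter_add_iff X S A).1 hA)
    rw [isPiecewiseSyndetic_iff] at hB ⊢
    obtain ⟨n, hn⟩ := hB
    refine ⟨n, fun l => ?_⟩
    obtain ⟨a, ha⟩ := hn l
    choose! i hi hin y hy hyx using ha
    -- Finitely many conditions, so a single `t` translates the whole covering of the interval.
    have hmem : (⋂ x ∈ Ico a (a + l), {t | y x + t ∈ A}) ∈ S :=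
      (Filter.biInter_mem (finite_Ico a (a + l))).2 fun x hx => hy x hx.1 hx.2
    obtain ⟨t, ht⟩ := S.nonempty_of_mem hmem
    simp only [mem_iInter] at ht
    refine ⟨a + t, fun x hx hxl => ?_⟩
    have h1 : a ≤ x - t := by omega
    have h2 : x - t < a + l := by omega
    have h3 := hyx _ h1 h2
    exact ⟨i (x - t), hi _ h1 h2, hin _ h1 h2, y (x - t) + t, ht (x - t) ⟨h1, h2⟩, by omega⟩

theorem isPiecewiseSyndetic_of_mem_closure_kernelBetaNat {U : Ultrafilter ℕ}
    (hU : U ∈ closure kernelBetaNat) {A : Set ℕ} (hA : A ∈ U) : IsPiecewiseSyndetic A := by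
  obtain ⟨V, hAV, hV⟩ := mem_closure_iff.1 hU _ (ultrafilter_isOpen_basic A) hA
  exact hV _ isTwoSidedAddIdeal_setOf_forall_isPiecewiseSyndetic A hAV

/-- A finitary form of van der Waerden's theorem. -/
theorem exists_mono_arithmetic_progression (k : ℕ) (κ : Type*) [Finite κ] :
    ∃ N : ℕ, ∀ C : ℕ → κ, ∃ b d : ℕ, ∃ c : κ, 0 < d ∧
      ∀ i < k, b + i * d < N ∧ C (b + i * d) = c := by
  classical
  obtain ⟨ι, _, hι⟩ := Combinatorics.Line.exists_mono_in_high_dimension (Fin k) κ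
  refine ⟨Fintype.card ι * k + 1, fun C => ?_⟩
  -- Coordinate sums send a combinatorial line to a progression whose difference is its number of
  -- active coordinates.
  obtain ⟨l, c, hl⟩ := hι fun v => C (∑ j, (v j : ℕ))
  let s : Finset ι := {j | l.idxFun j = none}
  have hsum (x : Fin k) : ∑ j, (l x j : ℕ) =
      ∑ j, ((l.idxFun j).map Fin.val).getD 0 + x * s.card := by
    have h (j : ι) : (l x j : ℕ) =
        ((l.idxFun j).map Fin.val).getD 0 + if l.idxFun j = none then (x : ℕ) else 0 := by
      cases hj : l.idxFun j with
      | none => simp [hj]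
      | some y => simp [hj]
    simp only [h, Finset.sum_add_distrib, ← Finset.sum_filter, Finset.sum_const, smul_eq_mul]
    rw [mul_comm]
  refine ⟨∑ j, ((l.idxFun j).map Fin.val).getD 0, s.card, c, Finset.card_pos.2 ?_,
    fun i hi => ?_⟩
  · obtain ⟨j, hj⟩ := l.proper
    exact ⟨j, by simp [s, hj]⟩
  · rw [← hsum ⟨i, hi⟩]
    refine ⟨Nat.lt_succ_of_le ?_, hl _⟩
    calc ∑ j, (l ⟨i, hi⟩ j : ℕ) ≤ ∑ _j : ι, k := Finset.sum_le_sum fun j _ => (l _ j).2.le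
      _ = Fintype.card ι * k := by simp

theorem IsPiecewiseSyndetic.containsArbitrarilyLongAP {A : Set ℕ} (hA : IsPiecewiseSyndetic A) :
    ContainsArbitrarilyLongAP A := by
  intro k
  obtain rfl | hk := k.eq_zero_or_pos
  · exact ⟨0, 1, one_pos, by simp⟩
  obtain ⟨n, hn⟩ := isPiecewiseSyndetic_iff.1 hA
  obtain ⟨N, hN⟩ := exists_mono_arithmetic_progression k (Fin (n + 1))
  obtain ⟨a, ha⟩ := hn N
  -- Points of one colour share a shift, so undoing it carries a monochromatic progression into `A`.
  have hcol (x : ℕ) : ∃ i : Fin (n + 1), x < N → ∃ y ∈ A, y + i = a + x := by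
    by_cases hx : x < N
    · obtain ⟨i, -, hin, h⟩ := ha (a + x) (by omega) (by omega)
      exact ⟨⟨i, by omega⟩, fun _ => h⟩
    · exact ⟨0, fun h => (hx h).elim⟩
  choose C hC using hcol
  obtain ⟨b, d, c, hd, h⟩ := hN C
  have key (i : ℕ) (hi : i < k) : ∃ y ∈ A, y + c = a + (b + i * d) := by
    obtain ⟨hlt, rfl⟩ := h i hi
    exact hC _ hlt
  obtain ⟨y₀, -, hy₀⟩ := key 0 hk
  refine ⟨y₀, d, hd, fun i hi => ?_⟩
  obtain ⟨y, hy, hyi⟩ := key i hi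
  have : y₀ + i * d = y := by omega
  rwa [this]

theorem ncard_inter_Ico_le (A : Set ℕ) (m n : ℕ) : (A ∩ Ico m (m + n)).ncard ≤ n := by
  calc (A ∩ Ico m (m + n)).ncard ≤ (Ico m (m + n)).ncard :=
        ncard_le_ncard inter_subset_right (finite_Ico _ _)
    _ = n := by rw [← Finset.coe_Ico, ncard_coe_finset]; simp

theorem ncard_inter_Ico_div_le_one (A : Set ℕ) (m n : ℕ) :
    ((A ∩ Ico m (m + n)).ncard : ℝ) / n ≤ 1 :=
  div_le_one_of_le₀ (by exact_mod_cast ncard_inter_Ico_le A m n) n.cast_nonneg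

theorem bddAbove_range_ncard_inter_Ico_div (A : Set ℕ) (n : ℕ) :
    BddAbove (range fun m : ℕ => ((A ∩ Ico m (m + n)).ncard : ℝ) / n) :=
  ⟨1, by rintro _ ⟨m, rfl⟩; exact ncard_inter_Ico_div_le_one A m n⟩

theorem le_upperBanachDensity {A : Set ℕ} {c : ℝ}
    (h : ∃ᶠ n : ℕ in atTop, ∃ m : ℕ, c ≤ ((A ∩ Ico m (m + n)).ncard : ℝ) / n) :
    c ≤ upperBanachDensity A := by
  refine le_limsup_of_frequently_le
    (h.mono fun n ⟨m, hm⟩ => hm.trans (le_ciSup (bddAbove_range_ncard_inter_Ico_div A n) m)) ?_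
  exact ⟨1, Filter.eventually_map.2 <| .of_forall fun n =>
    ciSup_le fun m => ncard_inter_Ico_div_le_one A m n⟩

theorem IsPiecewiseSyndetic.upperBanachDensity_pos {A : Set ℕ} (hA : IsPiecewiseSyndetic A) :
    0 < upperBanachDensity A := by
  obtain ⟨n, hn⟩ := isPiecewiseSyndetic_iff.1 hA
  have hn0 : 0 < n := by
    obtain ⟨a, ha⟩ := hn 1
    obtain ⟨i, hi, hin, -⟩ := ha a le_rfl (by omega)
    omega
  have hn0' : (0 : ℝ) < n := by exact_mod_cast hn0
  -- Covering `N - n ≥ N / 2` points by `n` translates takes at least `N / (2 * n)` elements of `A`.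
  refine lt_of_lt_of_le (by positivity : (0 : ℝ) < 1 / (2 * n))
    (le_upperBanachDensity (Filter.Eventually.frequently ?_))
  filter_upwards [eventually_ge_atTop (2 * n)] with N hN
  obtain ⟨a, ha⟩ := hn (N - n)
  -- Shifts are at most `n`, so starting `n` earlier (or at 0) captures every `y` used.
  refine ⟨a - n, ?_⟩
  have hfin : (A ∩ Ico (a - n) (a - n + N)).Finite := (finite_Ico _ _).subset inter_subset_right
  have hcard : N - n ≤ n * (A ∩ Ico (a - n) (a - n + N)).ncard := by
    choose! i hi hin y hy hyx using ha
    have := Finset.card_le_card_of_injOn (s := Finset.Ico a (a + (N - n)))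
      (t := Finset.Icc 1 n ×ˢ hfin.toFinset) (fun x => (i x, y x))
      (fun x hx => by
        rw [Finset.mem_coe, Finset.mem_Ico] at hx
        have h1 := hi x hx.1 hx.2
        have h2 := hin x hx.1 hx.2
        have h3 := hyx x hx.1 hx.2
        simp only [Finset.coe_product, mem_prod, Finset.mem_coe, Finset.mem_Icc,
          Set.Finite.mem_toFinset, mem_inter_iff, mem_Ico]
        exact ⟨⟨h1, h2⟩, hy x hx.1 hx.2, by omega, by omega⟩)
      (fun x hx x' hx' h => by
        rw [Finset.mem_coe, Finset.mem_Ico] at hx hx'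
        simp only [Prod.mk.injEq] at h
        rw [← hyx x hx.1 hx.2, ← hyx x' hx'.1 hx'.2, h.1, h.2])
    rw [Finset.card_product, ← ncard_eq_toFinset_card _ hfin] at this
    simpa using this
  have hN0 : (0 : ℝ) < N := by exact_mod_cast (by omega : 0 < N)
  have hle : N ≤ 2 * n * (A ∩ Ico (a - n) (a - n + N)).ncard := by
    rw [mul_assoc]
    omega
  rw [div_le_div_iff₀ (by positivity) hN0, one_mul, mul_comm]
  exact_mod_cast hle

theorem mainTheorem4 :
    (∀ U : Ultrafilter ℕ, U ∈ closure kernelBetaNat → ∀ A : Set ℕ, A ∈ U →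
      0 < upperBanachDensity A ∧ ContainsArbitrarilyLongAP A ∧ IsPiecewiseSyndetic A) ∧
    (∀ A : Set ℕ, IsPiecewiseSyndetic A →
      ContainsArbitrarilyLongAP A ∧ 0 < upperBanachDensity A) := by
  refine ⟨fun U hU A hA => ?_, fun A hA =>
    ⟨hA.containsArbitrarilyLongAP, hA.upperBanachDensity_pos⟩⟩
  have h := isPiecewiseSyndetic_of_mem_closure_kernelBetaNat hU hA
  exact ⟨h.upperBanachDensity_pos, h.containsArbitrarilyLongAP, h⟩
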